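/- Let $k$ be a field with algebraic closure $\bar k$, let $n \ge 1$, let $g_1,\dots,g_n \in k[x]$ be non-constant univariate polynomials, let $\mathbf a_1,\dots,\mathbf a_n \in k^n$ and $\mathbf b = (b_1,\dots,b_n)^\intercal \in k^n$, and put $f_i = g_i(\mathbf a_i^\intercal \mathbf x + b_i) \in P = k[x_1,\dots,x_n]$ and $\mathcal F = \{f_1,\dots,f_n\}$ (the affinely derived polynomial system of the $(g_i,\mathbf a_i,b_i)$). Assume that the matrix $\mathbf A = (\mathbf a_1 \ \dots \ \mathbf a_n)^\intercal \in k^{n\times n}$ has rank $n$. Then: 1. LEX and DRL Gröbner bases of $\mathcal F$ are obtained by an affine transformation: the affine change of variables $\mathbf y = \mathbf A\mathbf x + \mathbf b$ is invertible, with inverse $\mathbf x = \mathbf A^{-1}\mathbf y - \mathbf A^{-1}\mathbf b$; in the coordinates $\mathbf y$ the polynomial $f_i$ becomes $g_i(y_i)$; and $\{g_1(y_1),\dots,g_n(y_n)\}$ is a Gröbner basis of the transformed ideal $(\mathcal F) \subset k[y_1,\dots,y_n]$ for the lexicographic (LEX) and for the degree reverse lexicographic (DRL) term order, for every ordering of the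 variables $y_1, \dots, y_n$. (A Gröbner basis of an ideal $I$ is a finite generating set of $I$ whose leading terms generate the ideal of leading terms of all elements of $I$.) 2. $\mathcal F$ is zero-dimensional: $P/(\mathcal F)$ has Krull dimension $0$, and the zero locus of $\mathcal F$ in $\bar k^n$ is finite. 3. $P/(\mathcal F)$ is a finite-dimensional $k$-vector space, and $\dim_k P/(\mathcal F) = \prod_{i=1}^n \deg g_i$. 4. Let $\mathcal G \subset \bar k[x_1,\dots,x_n]$ be a set of polynomials with $\mathcal F \subset \mathcal G$ and $(\mathcal G) \ne (1)$, and let $\mathcal G^{\mathrm{hom}} = \{ h^{\mathrm{hom}} \mid h \in \mathcal G\} \subset \bar k[x_0,\dots,x_n]$, where $h^{\mathrm{hom}} = x_0^{\deg h}\, h(x_1/x_0,\dots,x_n/x_0)$. Then the ideal $J = (\mathcal G^{\mathrm{hom}})$ is in generic coordinates, that is: $J$ is homogeneous, its zero locus $\mathcal Z_+(J)$ in $\mathbb P^n_{\bar k}$ is finite, and either $\mathcal Z_+(J)$ is empty or $x_0$ is not a zero divisor on $\bar k[x_0,\dots,x_n]/J^{\mathrm{sat}}$, where $J^{\mathrm{sat}}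 = \bigcup_{i \ge 1} \big( J : (x_0,\dots,x_n)^i \big)$. 5. If in addition $k$ is a finite field with $q$ elements and $g_i \mid x^q - x$ for all $1 \le i \le n$, then every ideal $I \subset k[x_1,\dots,x_n]$ with $\mathcal F \subset I$ is radical. -/

import Mathlib

noncomputable section

attribute [local instance] MvPolynomial.gradedAlgebra

namespace AffineSystem

/-! ### Term orders -/

/-- The set of exponent vectors in `n` variables, to be equipped with the degree reverse
lexicographic order. -/
def DegRevLex (n : ℕ) : Type := Fin n →₀ ℕ

namespace DegRevLex

variable {n : ℕ}

instance : AddCommMonoid (DegRevLex n) := inferInstanceAs (AddCommMonoid (Fin n →₀ ℕ))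

/-- The exponent vector in which the variables are listed in the opposite order. -/
def rev (c : Fin n →₀ ℕ) : Fin n →₀ ℕ := Finsupp.domCongr Fin.revPerm c

/-- Degree first; ties are broken by the opposite of the lexicographic order for the reversed list
of variables. -/
def key (c : DegRevLex n) : ℕ ×ₗ (Lex (Fin n →₀ ℕ))ᵒᵈ :=
  toLex (Finsupp.degree (show Fin n →₀ ℕ from c), OrderDual.toDual (toLex (rev c)))

theorem key_injective : Function.Injective (key (n := n)) := by
  intro c d h
  have h2 := congrArg (fun z => ofLex (OrderDual.ofDual (ofLex z).2)) h
  exact (Finsupp.domCongr Fin.revPerm).injective h2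

instance : LinearOrder (DegRevLex n) := LinearOrder.lift' key key_injective

theorem le_iff_key {c d : DegRevLex n} : c ≤ d ↔ key c ≤ key d := Iff.rfl

theorem lt_iff_key {c d : DegRevLex n} : c < d ↔ key c < key d := Iff.rfl

instance : IsOrderedAddMonoid (DegRevLex n) where
  add_le_add_left a b h c := by
    rw [le_iff_key, Prod.Lex.le_iff] at h ⊢
    simp only [key, ofLex_toLex, OrderDual.toDual_le_toDual] at h ⊢
    have hd : ∀ x y : DegRevLex n, Finsupp.degree (show Fin n →₀ ℕ from x + y) =
        Finsupp.degree (show Fin n →₀ ℕ from x) + Finsupp.degree (show Fin n →₀ ℕ from y) :=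
      fun x y => map_add Finsupp.degree (show Fin n →₀ ℕ from x) (show Fin n →₀ ℕ from y)
    have hr : ∀ x y : DegRevLex n, toLex (rev (x + y)) = toLex (rev x) + toLex (rev y) :=
      fun x y => map_add (Finsupp.domCongr Fin.revPerm) (show Fin n →₀ ℕ from x)
        (show Fin n →₀ ℕ from y)
    rw [hd, hd, hr, hr]
    simpa using h

theorem monotone_id : Monotone (fun c : Fin n →₀ ℕ => (show DegRevLex n from c)) := by
  intro c d h
  obtain ⟨e, rfl⟩ := exists_add_of_le h
  rw [le_iff_key, Prod.Lex.le_iff]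
  simp only [key, ofLex_toLex, OrderDual.toDual_le_toDual]
  have hd : Finsupp.degree (c + e) = Finsupp.degree c + Finsupp.degree e := map_add _ _ _
  by_cases he : e = 0
  · right
    subst he
    simp
  · left
    have : Finsupp.degree e ≠ 0 := fun h0 => he ((Finsupp.degree_eq_zero_iff e).1 h0)
    change Finsupp.degree c < Finsupp.degree (c + e)
    omega

instance : WellFoundedLT (DegRevLex n) := by
  have h : WellQuasiOrdered (fun a b : Fin n →₀ ℕ => a ≤ b) := wellQuasiOrdered_le
  have h2 : WellQuasiOrderedLE (DegRevLex n) :=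
    ⟨fun f => by
      obtain ⟨i, j, hij, hle⟩ := h f
      exact ⟨i, j, hij, monotone_id hle⟩⟩
  infer_instance

end DegRevLex

/-- The degree reverse lexicographic order with `x₀ > x₁ > ⋯ > xₙ₋₁`. -/
def degRevLex (n : ℕ) : MonomialOrder (Fin n) where
  syn := DegRevLex n
  toSyn :=
  { toEquiv := Equiv.refl _
    map_add' := fun _ _ => rfl }
  toSyn_monotone := DegRevLex.monotone_id

/-- Among exponents of the same degree, `c` is smaller than `d` if and only if at the last place
where they differ the entry of `c` is the larger one. -/
theorem degRevLex_lt_iff {n : ℕ} {c d : Fin n →₀ ℕ} :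
    (degRevLex n).toSyn c < (degRevLex n).toSyn d ↔
      c.degree < d.degree ∨
        (c.degree = d.degree ∧ ∃ j, (∀ i, j < i → c i = d i) ∧ d j < c j) := by
  change DegRevLex.key (n := n) c < DegRevLex.key (n := n) d ↔ _
  rw [Prod.Lex.lt_iff]
  simp only [DegRevLex.key, ofLex_toLex, OrderDual.toDual_lt_toDual]
  refine or_congr Iff.rfl (and_congr Iff.rfl ?_)
  rw [Finsupp.Lex.lt_iff]
  simp only [ofLex_toLex, DegRevLex.rev, Finsupp.domCongr_apply, Finsupp.equivMapDomain_apply,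
    Fin.revPerm_symm, Fin.revPerm_apply]
  constructor
  · rintro ⟨j, h1, h2⟩
    refine ⟨j.rev, fun i hi => ?_, h2⟩
    have := h1 i.rev (by rw [← Fin.rev_lt_rev, Fin.rev_rev]; exact hi)
    simpa using this.symm
  · rintro ⟨j, h1, h2⟩
    refine ⟨j.rev, fun i hi => ?_, by simpa using h2⟩
    exact (h1 i.rev (by rw [← Fin.rev_lt_rev, Fin.rev_rev]; exact hi)).symm

/-- The term order obtained from `m` by letting the variable `e j` play the role of `j`. -/
def reorder {σ : Type*} (m : MonomialOrder σ) (e : Equiv.Perm σ) : MonomialOrder σ where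
  syn := m.syn
  toSyn := (Finsupp.domCongr e.symm).trans m.toSyn
  toSyn_monotone := by
    intro c d h
    refine m.toSyn_monotone fun i => ?_
    simpa using h (e i)

/-- The lexicographic order with `x_{e 0} > x_{e 1} > ⋯`. -/
def LEX {n : ℕ} (e : Equiv.Perm (Fin n)) : MonomialOrder (Fin n) := reorder MonomialOrder.lex e

/-- The degree reverse lexicographic order with `x_{e 0} > x_{e 1} > ⋯`. -/
def DRL {n : ℕ} (e : Equiv.Perm (Fin n)) : MonomialOrder (Fin n) := reorder (degRevLex n) e

/-- The set `G` is a Gröbner basis of the ideal `I` for the term order `m`. -/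
def IsGroebnerBasis {σ k : Type*} [Field k] (m : MonomialOrder σ)
    (I : Ideal (MvPolynomial σ k)) (G : Set (MvPolynomial σ k)) : Prop :=
  G.Finite ∧ Ideal.span G = I ∧
    Ideal.span (m.leadingTerm '' (I : Set (MvPolynomial σ k))) = Ideal.span (m.leadingTerm '' G)

/-! ### Affinely derived systems -/

/-- The affine form `aᵀ x + b`. -/
def affineForm {k : Type*} [Field k] {n : ℕ} (a : Fin n → k) (b : k) : MvPolynomial (Fin n) k :=
  ∑ j, MvPolynomial.C (a j) * MvPolynomial.X j + MvPolynomial.C b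

/-- The polynomials `g i (aᵢᵀ x + b i)`, where `aᵢ` is the `i`-th row of `A`. -/
def affinelyDerived {k : Type*} [Field k] {m n : ℕ} (g : Fin m → Polynomial k)
    (A : Matrix (Fin m) (Fin n) k) (b : Fin m → k) (i : Fin m) : MvPolynomial (Fin n) k :=
  Polynomial.aeval (affineForm (A i) (b i)) (g i)

/-! ### Zero loci -/

/-- The zero locus of `I` in affine space over the extension `L` of `k`. -/
def zeroLocus {k : Type*} [Field k] (L : Type*) [Field L] [Algebra k L] {n : ℕ}
    (I : Ideal (MvPolynomial (Fin n) k)) : Set (Fin n → L) :=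
  {x | ∀ f ∈ I, MvPolynomial.aeval x f = 0}

/-- The projective zero locus of a homogeneous ideal `I` over the extension `L` of `k`. -/
def projZeroLocus {k : Type*} [Field k] (L : Type*) [Field L] [Algebra k L] {n : ℕ}
    (I : Ideal (MvPolynomial (Fin n) k)) : Set (Projectivization L (Fin n → L)) :=
  {p | ∀ f ∈ I, MvPolynomial.aeval p.rep f = 0}

/-! ### Homogenization, saturation, generic coordinates -/

/-- The homogenization `x₀ ^ deg f * f (x₁ / x₀, …, xₙ / x₀)`. -/
def homogenize {k : Type*} [Field k] {n : ℕ} (f : MvPolynomial (Fin n) k) :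
    MvPolynomial (Fin (n + 1)) k :=
  ∑ d ∈ f.support, MvPolynomial.monomial (Finsupp.cons (f.totalDegree - d.degree) d) (f.coeff d)

/-- The saturation `I : J^∞ = ⋃ᵢ (I : J ^ i)`. -/
def saturation {R : Type*} [CommRing R] (I J : Ideal R) : Ideal R where
  carrier := {f | ∃ i : ℕ, ∀ g ∈ J ^ i, f * g ∈ I}
  zero_mem' := ⟨0, fun g _ => by simp⟩
  add_mem' := by
    rintro f f' ⟨i, hi⟩ ⟨j, hj⟩
    refine ⟨max i j, fun g hg => ?_⟩
    rw [add_mul]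
    exact I.add_mem (hi g (Ideal.pow_le_pow_right (le_max_left i j) hg))
      (hj g (Ideal.pow_le_pow_right (le_max_right i j) hg))
  smul_mem' := by
    rintro c f ⟨i, hi⟩
    refine ⟨i, fun g hg => ?_⟩
    rw [smul_eq_mul, mul_assoc]
    exact I.mul_mem_left c (hi g hg)

/-- The irrelevant ideal `(x₀, …, xₙ)`. -/
def irrelevantIdeal (k : Type*) [Field k] (n : ℕ) : Ideal (MvPolynomial (Fin (n + 1)) k) :=
  Ideal.span (Set.range MvPolynomial.X)

/-- An ideal of `K[x₀, …, xₙ]`, `K` an infinite field, is in generic coordinates: it is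
homogeneous, has finitely many projective zeros over the algebraic closure of `K`, and either it has
none or `x₀` is not a zero divisor modulo its saturation with respect to `(x₀, …, xₙ)`. -/
def IsInGenericCoordinates {K : Type*} [Field K] {n : ℕ}
    (I : Ideal (MvPolynomial (Fin (n + 1)) K)) : Prop :=
  I.IsHomogeneous (MvPolynomial.homogeneousSubmodule (Fin (n + 1)) K) ∧
    (projZeroLocus (AlgebraicClosure K) I).Finite ∧
      (projZeroLocus (AlgebraicClosure K) I = ∅ ∨
        Ideal.Quotient.mk (saturation I (irrelevantIdeal K n)) (MvPolynomial.X 0) ∈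
          nonZeroDivisors
            (MvPolynomial (Fin (n + 1)) K ⧸ saturation I (irrelevantIdeal K n)))

end AffineSystem

end

noncomputable section

namespace AffineSystem

open MvPolynomial

/-! ### Normal forms modulo a system of univariate polynomials -/

section NormalForm

variable {σ k : Type*} [Field k]

/-! Since `A` is invertible, `y = A x + b` is an automorphism of the polynomial ring, and the system
becomes `g i (y i)`, one polynomial per variable.

For such a system, reducing each power of `y i` modulo `g i` defines a linear map `normalForm`. It
kills the ideal (`normalForm_eq_zero_of_mem`), changes a polynomial only by an element of the ideal
(`sub_normalForm_mem`), and never raises an exponent (`le_of_mem_support_reduceMonomial`). So an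
irreducible leading monomial would survive in the normal form, and a nonzero element of the ideal
cannot have one. This gives the Gröbner basis for every term order at once. The reduced monomials
form a basis of the quotient, whence the dimension formula, the Artinian property and Krull
dimension 0. Zeros embed into a product of root sets.

Generic coordinates: modulo `x₀` the homogenized system consists of nonzero constants times powers
of independent linear forms, so a power of the irrelevant ideal lies in `J + (x₀)`
(`exists_irrelevantIdeal_pow_le`). Hence no projective zero has `x₀ = 0`, and `x₀` is regular modulo
the saturation (`mem_saturation_of_mul_mem`).

Radicality: the `q`-power map on the quotient is a `k`-algebra endomorphism fixing the generators `y
i`, so it is the identity and leaves no nonzero nilpotents. -/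

theorem aeval_X_eq_sum (i : σ) (p : Polynomial k) :
    Polynomial.aeval (X i : MvPolynomial σ k) p =
      p.sum fun j a => monomial (Finsupp.single i j) a := by
  rw [Polynomial.aeval_def, Polynomial.eval₂_eq_sum]
  refine Finset.sum_congr rfl fun j _ => ?_
  exact C_mul_X_pow_eq_monomial

theorem exists_of_mem_support_aeval_X {i : σ} {p : Polynomial k} {c : σ →₀ ℕ}
    (hc : c ∈ (Polynomial.aeval (X i : MvPolynomial σ k) p).support) :
    ∃ j ≤ p.natDegree, c = Finsupp.single i j := by
  classical
  rw [aeval_X_eq_sum, Polynomial.sum] at hc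
  obtain ⟨j, hj, hcj⟩ := Finset.mem_biUnion.1 (support_sum hc)
  exact ⟨j, Polynomial.le_natDegree_of_mem_supp j hj,
    Finset.mem_singleton.1 (support_monomial_subset hcj)⟩

theorem coeff_single_aeval_X (i : σ) (p : Polynomial k) (j : ℕ) :
    (Polynomial.aeval (X i : MvPolynomial σ k) p).coeff (Finsupp.single i j) = p.coeff j := by
  classical
  rw [aeval_X_eq_sum, Polynomial.sum, coeff_sum]
  simp only [coeff_monomial, (Finsupp.single_injective i).eq_iff, Finset.sum_ite_eq',
    Polynomial.mem_support_iff, ne_eq, ite_not]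
  split_ifs with h <;> simp [h]

theorem degreeOf_aeval_X_self_le (i : σ) (p : Polynomial k) :
    degreeOf i (Polynomial.aeval (X i : MvPolynomial σ k) p) ≤ p.natDegree := by
  rw [degreeOf_le_iff]
  intro c hc
  obtain ⟨j, hj, rfl⟩ := exists_of_mem_support_aeval_X hc
  simpa using hj

theorem degreeOf_aeval_X_of_ne {i j : σ} (h : j ≠ i) (p : Polynomial k) :
    degreeOf i (Polynomial.aeval (X j : MvPolynomial σ k) p) = 0 := by
  refine Nat.le_zero.1 (degreeOf_le_iff.2 fun c hc => ?_)
  obtain ⟨l, -, rfl⟩ := exists_of_mem_support_aeval_X hc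
  simp [h.symm]

/-- The powers of a single variable are ordered in the same way by every term order. -/
theorem degree_aeval_X (m : MonomialOrder σ) (i : σ) {p : Polynomial k} (hp : p ≠ 0) :
    m.degree (Polynomial.aeval (X i : MvPolynomial σ k) p) = Finsupp.single i p.natDegree := by
  apply m.toSyn.injective
  apply le_antisymm
  · rw [m.degree_le_iff]
    intro c hc
    obtain ⟨j, hj, rfl⟩ := exists_of_mem_support_aeval_X hc
    exact m.toSyn_monotone (Finsupp.single_mono hj)
  · apply m.le_degree
    rw [mem_support_iff, coeff_single_aeval_X]
    simpa using hp

theorem C_mul_mod (a : k) (p q : Polynomial k) :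
    (Polynomial.C a * p) % q = Polynomial.C a * (p % q) := by
  rw [Polynomial.mod_def, Polynomial.mod_def, ← Polynomial.smul_eq_C_mul,
    Polynomial.smul_modByMonic, Polynomial.smul_eq_C_mul]

theorem X_pow_mod_of_lt {p : Polynomial k} {j : ℕ} (h : j < p.natDegree) :
    (Polynomial.X ^ j) % p = Polynomial.X ^ j := by
  have hp : p ≠ 0 := Polynomial.ne_zero_of_natDegree_gt h
  rw [Polynomial.mod_eq_self_iff hp, Polynomial.degree_X_pow, Polynomial.degree_eq_natDegree hp]
  exact_mod_cast h

variable [Fintype σ]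

/-- The product of the remainders of the powers `X i ^ d i` modulo `g i`. -/
def reduceMonomial (g : σ → Polynomial k) (d : σ →₀ ℕ) : MvPolynomial σ k :=
  ∏ i, Polynomial.aeval (X i) ((Polynomial.X ^ d i) % g i)

/-- The normal form modulo the polynomials `g i (X i)`. -/
def normalForm (g : σ → Polynomial k) : MvPolynomial σ k →ₗ[k] MvPolynomial σ k :=
  (basisMonomials σ k).constr k (reduceMonomial g)

theorem normalForm_monomial (g : σ → Polynomial k) (d : σ →₀ ℕ) (a : k) :
    normalForm g (monomial d a) = a • reduceMonomial g d := by
  have h : normalForm g (monomial d 1) = reduceMonomial g d := by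
    have := (basisMonomials σ k).constr_basis k (reduceMonomial g) d
    rwa [coe_basisMonomials] at this
  rw [← h, ← map_smul, smul_monomial, smul_eq_mul, mul_one]

theorem normalForm_eq_sum (g : σ → Polynomial k) (f : MvPolynomial σ k) :
    normalForm g f = ∑ d ∈ f.support, f.coeff d • reduceMonomial g d := by
  conv_lhs => rw [f.as_sum]
  simp only [map_sum, normalForm_monomial]

/-- A factor in `X i` alone affects only the `i`-th remainder; for `p = g i` that remainder
vanishes. -/
theorem normalForm_aeval_X_mul_monomial [DecidableEq σ] (g : σ → Polynomial k) (i : σ)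
    (p : Polynomial k) (d : σ →₀ ℕ) :
    normalForm g (Polynomial.aeval (X i) p * monomial d 1) =
      Polynomial.aeval (X i) ((p * Polynomial.X ^ d i) % g i) *
        ∏ l ∈ Finset.univ.erase i, Polynomial.aeval (X l) ((Polynomial.X ^ d l) % g l) := by
  induction p using Polynomial.induction_on' with
  | add p q hp hq =>
    rw [map_add, add_mul, map_add, hp, hq, add_mul p q, Polynomial.add_mod, map_add, add_mul]
  | monomial j a =>
    have h : Polynomial.aeval (X i : MvPolynomial σ k) (Polynomial.monomial j a) *
        monomial d 1 = monomial (Finsupp.single i j + d) a := by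
      rw [Polynomial.aeval_monomial, algebraMap_eq, C_mul_X_pow_eq_monomial, monomial_mul, mul_one]
    rw [h, normalForm_monomial, reduceMonomial, ← Finset.mul_prod_erase _ _ (Finset.mem_univ i),
      ← Polynomial.C_mul_X_pow_eq_monomial, mul_assoc, ← pow_add, C_mul_mod, map_mul,
      Polynomial.aeval_C, algebraMap_eq, smul_eq_C_mul, mul_assoc]
    congr 2
    · simp
    · refine Finset.prod_congr rfl fun l hl => ?_
      simp [Finset.ne_of_mem_erase hl]

theorem normalForm_eq_zero_of_mem {g : σ → Polynomial k} {f : MvPolynomial σ k}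
    (hf : f ∈ Ideal.span (Set.range fun i => Polynomial.aeval (X i : MvPolynomial σ k) (g i))) :
    normalForm g f = 0 := by
  classical
  obtain ⟨c, rfl⟩ := (Ideal.mem_span_range_iff_exists_fun).1 hf
  rw [map_sum]
  refine Finset.sum_eq_zero fun i _ => ?_
  conv_lhs => rw [(c i).as_sum, Finset.sum_mul, map_sum]
  refine Finset.sum_eq_zero fun d _ => ?_
  have h : monomial d ((c i).coeff d) * Polynomial.aeval (X i : MvPolynomial σ k) (g i) =
      (c i).coeff d • (Polynomial.aeval (X i : MvPolynomial σ k) (g i) * monomial d 1) := by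
    rw [← mul_smul_comm, smul_monomial, smul_eq_mul, mul_one, mul_comm]
  rw [h, map_smul, normalForm_aeval_X_mul_monomial,
    EuclideanDomain.mod_eq_zero.2 (dvd_mul_right _ _)]
  simp

theorem sub_normalForm_mem (g : σ → Polynomial k) (f : MvPolynomial σ k) :
    f - normalForm g f ∈
      Ideal.span (Set.range fun i => Polynomial.aeval (X i : MvPolynomial σ k) (g i)) := by
  set I := Ideal.span (Set.range fun i => Polynomial.aeval (X i : MvPolynomial σ k) (g i))
  have hmod : ∀ i p, Ideal.Quotient.mk I (Polynomial.aeval (X i) (p % g i)) =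
      Ideal.Quotient.mk I (Polynomial.aeval (X i) p) := by
    intro i p
    rw [eq_comm, Ideal.Quotient.eq, ← map_sub]
    have h : p - p % g i = g i * (p / g i) :=
      sub_eq_of_eq_add (EuclideanDomain.div_add_mod p (g i)).symm
    rw [h, map_mul]
    exact I.mul_mem_right _ (Ideal.subset_span ⟨i, rfl⟩)
  rw [← Ideal.Quotient.eq]
  induction f using MvPolynomial.induction_on' with
  | add p q hp hq => rw [map_add, map_add, map_add, hp, hq]
  | monomial d a =>
    rw [normalForm_monomial, monomial_eq, smul_eq_C_mul, map_mul, map_mul, reduceMonomial,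
      map_prod, Finsupp.prod_fintype _ _ (fun i => pow_zero _), map_prod]
    congr 1
    refine Finset.prod_congr rfl fun i _ => ?_
    rw [hmod, map_pow (Polynomial.aeval _), Polynomial.aeval_X]

theorem le_of_mem_support_reduceMonomial {g : σ → Polynomial k} (hg : ∀ i, 0 < (g i).natDegree)
    {c d : σ →₀ ℕ} (hc : c ∈ (reduceMonomial g d).support) (i : σ) :
    c i ≤ d i ∧ c i < (g i).natDegree := by
  classical
  have h : c i ≤ ((Polynomial.X ^ d i) % g i).natDegree := by
    refine (monomial_le_degreeOf i hc).trans ((degreeOf_prod_le i _ _).trans ?_)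
    rw [Finset.sum_eq_single i (fun j _ hj => degreeOf_aeval_X_of_ne hj _) (by simp)]
    exact degreeOf_aeval_X_self_le i _
  have hlt : ((Polynomial.X ^ d i) % g i).natDegree < (g i).natDegree :=
    Polynomial.natDegree_mod_lt _ (hg i).ne'
  refine ⟨?_, h.trans_lt hlt⟩
  -- Either nothing is reduced in the `i`-th variable, or the remainder has degree below `deg (g i)
  -- ≤ d i`.
  rcases lt_or_ge (d i) (g i).natDegree with hd | hd
  · rw [X_pow_mod_of_lt hd] at h
    simpa using h
  · omega

theorem reduceMonomial_eq_monomial {g : σ → Polynomial k} {d : σ →₀ ℕ}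
    (hd : ∀ i, d i < (g i).natDegree) : reduceMonomial g d = monomial d 1 := by
  rw [monomial_eq, map_one, one_mul, Finsupp.prod_fintype _ _ (fun i => pow_zero _)]
  refine Finset.prod_congr rfl fun i _ => ?_
  rw [X_pow_mod_of_lt (hd i)]
  simp

/-- Otherwise the leading monomial is its own normal form. No other monomial of `f` can cancel it,
because reduction only produces componentwise smaller exponents; its coefficient in the normal form,
which is zero, would be the leading coefficient. -/
theorem exists_natDegree_le_degree (m : MonomialOrder σ) {g : σ → Polynomial k}
    (hg : ∀ i, 0 < (g i).natDegree) {f : MvPolynomial σ k} (hf0 : f ≠ 0)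
    (hf : f ∈ Ideal.span (Set.range fun i => Polynomial.aeval (X i : MvPolynomial σ k) (g i))) :
    ∃ i, (g i).natDegree ≤ m.degree f i := by
  classical
  by_contra! hd
  have h := congrArg (coeff (m.degree f)) (normalForm_eq_zero_of_mem hf)
  rw [normalForm_eq_sum, coeff_sum, Finset.sum_eq_single (m.degree f), coeff_smul,
    reduceMonomial_eq_monomial hd, coeff_monomial, if_pos rfl, smul_eq_mul, mul_one,
    coeff_zero, m.coeff_degree_eq_zero_iff] at h
  · exact hf0 h
  · intro c hc hne
    rw [coeff_smul, smul_eq_mul]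
    by_contra hcd
    have hle : m.degree f ≤ c := fun i =>
      (le_of_mem_support_reduceMonomial hg (mem_support_iff.2 (right_ne_zero_of_mul hcd)) i).1
    exact hne (m.toSyn.injective (le_antisymm (m.le_degree hc) (m.toSyn_monotone hle)))
  · intro h
    rw [notMem_support_iff.1 h, zero_smul, coeff_zero]

theorem isGroebnerBasis_aeval_X (m : MonomialOrder σ) {g : σ → Polynomial k}
    (hg : ∀ i, 0 < (g i).natDegree) :
    IsGroebnerBasis m
      (Ideal.span (Set.range fun i => Polynomial.aeval (X i : MvPolynomial σ k) (g i)))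
      (Set.range fun i => Polynomial.aeval (X i : MvPolynomial σ k) (g i)) := by
  refine ⟨Set.finite_range _, rfl, le_antisymm ?_
    (Ideal.span_mono (Set.image_mono Ideal.subset_span))⟩
  rw [Ideal.span_le]
  rintro _ ⟨f, hf, rfl⟩
  by_cases hf0 : f = 0
  · simp [hf0]
  obtain ⟨i, hi⟩ := exists_natDegree_le_degree m hg hf0 hf
  have hg0 : g i ≠ 0 := Polynomial.ne_zero_of_natDegree_gt (hg i)
  have hlead : m.leadingTerm (Polynomial.aeval (X i : MvPolynomial σ k) (g i)) =
      monomial (Finsupp.single i (g i).natDegree) (g i).leadingCoeff := by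
    rw [MonomialOrder.leadingTerm, MonomialOrder.leadingCoeff, degree_aeval_X m i hg0,
      coeff_single_aeval_X, Polynomial.leadingCoeff]
  have hle : Finsupp.single i (g i).natDegree ≤ m.degree f := by simpa using hi
  have h : m.leadingTerm f =
      monomial (m.degree f - Finsupp.single i (g i).natDegree)
        (m.leadingCoeff f * (g i).leadingCoeff⁻¹) *
        m.leadingTerm (Polynomial.aeval (X i : MvPolynomial σ k) (g i)) := by
    rw [hlead, monomial_mul, tsub_add_cancel_of_le hle,
      inv_mul_cancel_right₀ (Polynomial.leadingCoeff_ne_zero.2 hg0), MonomialOrder.leadingTerm]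
  rw [SetLike.mem_coe, h]
  exact Ideal.mul_mem_left _ _ (Ideal.subset_span ⟨_, ⟨i, rfl⟩, rfl⟩)

/-- The quotient by the polynomials `g i (X i)` has the reduced monomials as a basis. -/
def quotientEquivRestrictSupport {g : σ → Polynomial k} (hg : ∀ i, 0 < (g i).natDegree) :
    (MvPolynomial σ k ⧸
      Ideal.span (Set.range fun i => Polynomial.aeval (X i : MvPolynomial σ k) (g i))) ≃ₗ[k]
      restrictSupport k {d : σ →₀ ℕ | ∀ i, d i < (g i).natDegree} :=
  let S : Set (σ →₀ ℕ) := {d | ∀ i, d i < (g i).natDegree}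
  let I := Ideal.span (Set.range fun i => Polynomial.aeval (X i : MvPolynomial σ k) (g i))
  let N : MvPolynomial σ k →ₗ[k] restrictSupport k S :=
    (normalForm g).codRestrict _ fun f => by
      rw [normalForm_eq_sum]
      refine Submodule.sum_mem _ fun d _ => Submodule.smul_mem _ _ ?_
      rw [mem_restrictSupport_iff]
      exact fun c hc i => (le_of_mem_support_reduceMonomial hg hc i).2
  have hker : I.restrictScalars k = LinearMap.ker N := by
    ext f
    rw [LinearMap.ker_codRestrict, LinearMap.mem_ker, Submodule.restrictScalars_mem]
    refine ⟨normalForm_eq_zero_of_mem, fun h => ?_⟩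
    have := sub_normalForm_mem g f
    rwa [h, sub_zero] at this
  -- Polynomials supported on reduced exponents are fixed by `normalForm`.
  have hsurj : Function.Surjective N := by
    rintro ⟨f, hf⟩
    refine ⟨f, Subtype.ext ?_⟩
    change normalForm g f = f
    rw [normalForm_eq_sum]
    conv_rhs => rw [f.as_sum]
    refine Finset.sum_congr rfl fun d hd => ?_
    rw [reduceMonomial_eq_monomial (hf hd), smul_monomial, smul_eq_mul, mul_one]
  (Submodule.Quotient.restrictScalarsEquiv k I).symm ≪≫ₗ Submodule.quotEquivOfEq _ _ hker ≪≫ₗ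
    N.quotKerEquivOfSurjective hsurj

/-- Reduced exponents as tuples. -/
def reducedExponentsEquiv (D : σ → ℕ) : {d : σ →₀ ℕ | ∀ i, d i < D i} ≃ ∀ i, Fin (D i) where
  toFun d i := ⟨d.1 i, d.2 i⟩
  invFun e := ⟨Finsupp.equivFunOnFinite.symm fun i => (e i : ℕ), fun i => (e i).2⟩
  left_inv d := by
    ext
    rfl
  right_inv e := rfl

theorem finite_quotient_aeval_X {g : σ → Polynomial k} (hg : ∀ i, 0 < (g i).natDegree) :
    Module.Finite k (MvPolynomial σ k ⧸
      Ideal.span (Set.range fun i => Polynomial.aeval (X i : MvPolynomial σ k) (g i))) := by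
  classical
  have : Finite {d : σ →₀ ℕ | ∀ i, d i < (g i).natDegree} :=
    Finite.of_equiv _ (reducedExponentsEquiv fun i => (g i).natDegree).symm
  have := Module.Finite.of_basis
    (basisRestrictSupport k {d : σ →₀ ℕ | ∀ i, d i < (g i).natDegree})
  exact Module.Finite.equiv (quotientEquivRestrictSupport hg).symm

theorem finrank_quotient_aeval_X {g : σ → Polynomial k} (hg : ∀ i, 0 < (g i).natDegree) :
    Module.finrank k (MvPolynomial σ k ⧸
      Ideal.span (Set.range fun i => Polynomial.aeval (X i : MvPolynomial σ k) (g i))) =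
      ∏ i, (g i).natDegree := by
  classical
  rw [(quotientEquivRestrictSupport hg).finrank_eq,
    Module.finrank_eq_nat_card_basis (basisRestrictSupport k _),
    Nat.card_congr (reducedExponentsEquiv fun i => (g i).natDegree), Nat.card_pi]
  simp

end NormalForm

end AffineSystem

end

noncomputable section

attribute [local instance] MvPolynomial.gradedAlgebra

namespace AffineSystem

open MvPolynomial

/-! ### The affine change of variables -/

section ChangeOfVariables

variable {k : Type*} [Field k] {n : ℕ}

theorem aeval_affineForm {S : Type*} [CommRing S] [Algebra k S] (v : Fin n → S) (a : Fin n → k)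
    (c : k) :
    aeval v (affineForm a c) = ∑ j, algebraMap k S (a j) * v j + algebraMap k S c := by
  simp [affineForm]

/-- Composition law for affine maps, row by row; it verifies the inverse substitution. -/
theorem aeval_affineForm_affineForm (A : Matrix (Fin n) (Fin n) k) (b a : Fin n → k) (c : k) :
    aeval (fun i => affineForm (A i) (b i)) (affineForm a c) =
      affineForm (Matrix.vecMul a A) (a ⬝ᵥ b + c) := by
  rw [aeval_affineForm]
  simp only [affineForm, algebraMap_eq, mul_add, Finset.sum_add_distrib, Finset.mul_sum,
    Matrix.vecMul, dotProduct, map_add, map_sum, map_mul, Finset.sum_mul]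
  rw [Finset.sum_comm, add_assoc]
  simp only [mul_assoc]

theorem affineForm_one (i : Fin n) :
    affineForm ((1 : Matrix (Fin n) (Fin n) k) i) 0 = X i := by
  simp [affineForm, Matrix.one_apply]

/-- The substitution of `A x + b` for the variables. -/
def affineEquiv (A : Matrix (Fin n) (Fin n) k) (b : Fin n → k) (hA : IsUnit A.det) :
    MvPolynomial (Fin n) k ≃ₐ[k] MvPolynomial (Fin n) k :=
  AlgEquiv.ofAlgHom (aeval fun i => affineForm (A i) (b i))
    (aeval fun i => affineForm (A⁻¹ i) (-(A⁻¹.mulVec b) i))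
    (by
      ext1 i
      rw [AlgHom.comp_apply, aeval_X, aeval_affineForm_affineForm, ← Matrix.mul_apply_eq_vecMul,
        Matrix.nonsing_inv_mul A hA, Matrix.mulVec, add_neg_cancel, affineForm_one,
        AlgHom.id_apply])
    (by
      ext1 i
      have h : A i ⬝ᵥ (fun j => -(A⁻¹.mulVec b) j) + b i = 0 := by
        have : A.mulVec (-(A⁻¹.mulVec b)) i = -b i := by
          rw [Matrix.mulVec_neg, Matrix.mulVec_mulVec, Matrix.mul_nonsing_inv A hA,
            Matrix.one_mulVec, Pi.neg_apply]
        rw [Matrix.mulVec] at this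
        exact (congrArg (· + b i) this).trans (neg_add_cancel _)
      rw [AlgHom.comp_apply, aeval_X, aeval_affineForm_affineForm, h,
        ← Matrix.mul_apply_eq_vecMul, Matrix.mul_nonsing_inv A hA, affineForm_one,
        AlgHom.id_apply])

theorem affineEquiv_X (A : Matrix (Fin n) (Fin n) k) (b : Fin n → k) (hA : IsUnit A.det)
    (i : Fin n) : affineEquiv A b hA (X i) = affineForm (A i) (b i) :=
  aeval_X _ i

theorem affineEquiv_symm_X (A : Matrix (Fin n) (Fin n) k) (b : Fin n → k) (hA : IsUnit A.det)
    (i : Fin n) :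
    (affineEquiv A b hA).symm (X i) = affineForm (A⁻¹ i) (-(A⁻¹.mulVec b) i) :=
  aeval_X _ i

theorem affineEquiv_symm_affinelyDerived (g : Fin n → Polynomial k)
    (A : Matrix (Fin n) (Fin n) k) (b : Fin n → k) (hA : IsUnit A.det) (i : Fin n) :
    (affineEquiv A b hA).symm (affinelyDerived g A b i) = Polynomial.aeval (X i) (g i) := by
  rw [AlgEquiv.symm_apply_eq, ← AlgEquiv.coe_toAlgHom, ← Polynomial.aeval_algHom_apply,
    AlgEquiv.coe_toAlgHom, affineEquiv_X, affinelyDerived]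

theorem map_span_affinelyDerived (g : Fin n → Polynomial k)
    (A : Matrix (Fin n) (Fin n) k) (b : Fin n → k) (hA : IsUnit A.det) :
    (Ideal.span (Set.range (affinelyDerived g A b))).map (affineEquiv A b hA).symm =
      Ideal.span (Set.range fun i => Polynomial.aeval (X i : MvPolynomial (Fin n) k) (g i)) := by
  rw [Ideal.map_span, ← Set.range_comp]
  congr 2
  ext1 i
  exact affineEquiv_symm_affinelyDerived g A b hA i

/-- The quotient in the original and in the transformed coordinates. -/
def quotientAffinelyDerivedEquiv (g : Fin n → Polynomial k)
    (A : Matrix (Fin n) (Fin n) k) (b : Fin n → k) (hA : IsUnit A.det) :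
    (MvPolynomial (Fin n) k ⧸ Ideal.span (Set.range (affinelyDerived g A b))) ≃ₐ[k]
      MvPolynomial (Fin n) k ⧸
        Ideal.span (Set.range fun i => Polynomial.aeval (X i : MvPolynomial (Fin n) k) (g i)) :=
  Ideal.quotientEquivAlg _ _ (affineEquiv A b hA).symm (map_span_affinelyDerived g A b hA).symm

theorem finite_zeros_affinelyDerived (L : Type*) [Field L] [Algebra k L]
    {g : Fin n → Polynomial k} (hg : ∀ i, g i ≠ 0) (A : Matrix (Fin n) (Fin n) k) (b : Fin n → k)
    (hA : IsUnit A.det) :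
    {x : Fin n → L | ∀ i, aeval x (affinelyDerived g A b i) = 0}.Finite := by
  classical
  refine Set.Finite.of_injOn (t := Set.univ.pi fun i => (g i).rootSet L)
    (f := fun x i => aeval x (affineForm (A i) (b i))) ?_ ?_
    (Set.Finite.pi fun i => (g i).rootSet_finite L)
  · intro x hx i _
    rw [Polynomial.mem_rootSet]
    refine ⟨hg i, ?_⟩
    rw [Polynomial.aeval_algHom_apply]
    exact hx i
  · intro x _ x' _ h
    -- Injectivity: equal values of the affine forms make the two evaluations agree after the
    -- automorphism; undoing it recovers the coordinates.
    have hcomp : (aeval x).comp (affineEquiv A b hA).toAlgHom =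
        (aeval x').comp (affineEquiv A b hA).toAlgHom := by
      ext i
      simpa [affineEquiv_X] using congrFun h i
    ext i
    have := DFunLike.congr_fun hcomp ((affineEquiv A b hA).symm (X i))
    simpa using this

/-- In the quotient by `I` each affine form is a root of `g i`, hence of `X ^ q - X`. As these forms
generate the algebra, Frobenius is the identity there. -/
theorem isRadical_of_affinelyDerived_mem [Finite k] {g : Fin n → Polynomial k}
    (hg : ∀ i, g i ∣ (Polynomial.X ^ Nat.card k - Polynomial.X : Polynomial k))
    (A : Matrix (Fin n) (Fin n) k) (b : Fin n → k) (hA : IsUnit A.det)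
    {I : Ideal (MvPolynomial (Fin n) k)} (hI : ∀ i, affinelyDerived g A b i ∈ I) :
    I.IsRadical := by
  have := Fintype.ofFinite k
  have hfix : (FiniteField.frobeniusAlgHom k (MvPolynomial (Fin n) k ⧸ I)).comp
      ((Ideal.Quotient.mkₐ k I).comp (affineEquiv A b hA).toAlgHom) =
      (Ideal.Quotient.mkₐ k I).comp (affineEquiv A b hA).toAlgHom := by
    ext1 i
    simp only [AlgHom.comp_apply, AlgEquiv.coe_toAlgHom, affineEquiv_X,
      FiniteField.coe_frobeniusAlgHom, Ideal.Quotient.mkₐ_eq_mk]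
    obtain ⟨q, hq⟩ := hg i
    have h := congrArg (Polynomial.aeval (affineForm (A i) (b i))) hq
    rw [map_mul, map_sub, map_pow, Polynomial.aeval_X, Nat.card_eq_fintype_card] at h
    rw [← map_pow, Ideal.Quotient.eq, h]
    exact I.mul_mem_right _ (hI i)
  have hpow : ∀ z : MvPolynomial (Fin n) k ⧸ I, z ^ Fintype.card k = z := by
    intro z
    obtain ⟨f, rfl⟩ := Ideal.Quotient.mk_surjective z
    have := DFunLike.congr_fun hfix ((affineEquiv A b hA).symm f)
    simpa using this
  have hiter : ∀ (z : MvPolynomial (Fin n) k ⧸ I) (N : ℕ), z ^ Fintype.card k ^ N = z := by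
    intro z N
    induction N with
    | zero => simp
    | succ N ih => rw [pow_succ, pow_mul, ih, hpow]
  rintro f ⟨N, hN⟩
  rw [← Ideal.Quotient.eq_zero_iff_mem, map_pow] at hN
  rw [← Ideal.Quotient.eq_zero_iff_mem, ← hiter (Ideal.Quotient.mk I f) N]
  -- `N < q ^ N`, so the vanishing `N`-th power forces the class of `f`, equal to its `q ^ N`-th
  -- power, to be zero.
  exact pow_eq_zero_of_le (Nat.lt_pow_self Fintype.one_lt_card).le hN

end ChangeOfVariables

/-! ### Homogenization and generic coordinates -/

section GenericCoordinates

/-- Distinct powers of a linear form lie in distinct degrees. -/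
theorem homogeneousComponent_aeval_of_isHomogeneous_one {σ k : Type*} [Field k]
    {l : MvPolynomial σ k} (hl : l.IsHomogeneous 1) (p : Polynomial k) (j : ℕ) :
    homogeneousComponent j (Polynomial.aeval l p) = C (p.coeff j) * l ^ j := by
  have hpow : ∀ i, (l ^ i).IsHomogeneous i := fun i => by simpa using hl.pow i
  rw [Polynomial.aeval_eq_sum_range, map_sum]
  have h : ∀ i, homogeneousComponent j (p.coeff i • l ^ i) =
      if i = j then C (p.coeff j) * l ^ j else 0 := by
    intro i
    rw [map_smul, homogeneousComponent_of_mem ((mem_homogeneousSubmodule _ _).2 (hpow i))]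
    by_cases hij : i = j
    · simp [hij, smul_eq_C_mul]
    · simp [hij, Ne.symm hij]
  simp only [h, Finset.sum_ite_eq', Finset.mem_range]
  split_ifs with hj
  · rfl
  · rw [Polynomial.coeff_eq_zero_of_natDegree_lt (by omega), map_zero, zero_mul]

theorem totalDegree_aeval_of_isHomogeneous_one {σ k : Type*} [Field k]
    {l : MvPolynomial σ k} (hl : l.IsHomogeneous 1) (hl0 : l ≠ 0) (p : Polynomial k) :
    (Polynomial.aeval l p).totalDegree = p.natDegree := by
  by_cases hp : p = 0
  · simp [hp]
  apply le_antisymm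
  · rw [Polynomial.aeval_eq_sum_range]
    refine totalDegree_finsetSum_le fun i hi => (totalDegree_smul_le _ _).trans ?_
    have : (l ^ i).IsHomogeneous i := by simpa using hl.pow i
    exact this.totalDegree_le.trans (Nat.lt_succ_iff.1 (Finset.mem_range.1 hi))
  · by_contra! h
    have h0 := homogeneousComponent_eq_zero _ _ h
    rw [homogeneousComponent_aeval_of_isHomogeneous_one hl] at h0
    exact mul_ne_zero (by simpa using hp) (pow_ne_zero _ hl0) h0

variable {K : Type*} [Field K] {n : ℕ}

theorem isHomogeneous_affineForm_zero (a : Fin n → K) : (affineForm a 0).IsHomogeneous 1 := by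
  rw [affineForm, map_zero, add_zero]
  refine IsHomogeneous.sum _ _ _ fun j _ => ?_
  simpa using (isHomogeneous_C (Fin n) (a j)).mul (isHomogeneous_X K j)

/-- The constant term is absorbed into the univariate polynomial by a Taylor shift, which preserves
its degree; the results on homogeneous linear forms then apply. -/
theorem aeval_affineForm_eq_aeval_taylor (a : Fin n → K) (c : K) (p : Polynomial K) :
    Polynomial.aeval (affineForm a c) p =
      Polynomial.aeval (affineForm a 0) (Polynomial.taylor c p) := by
  rw [Polynomial.taylor_apply, Polynomial.aeval_comp]
  congr 2
  simp [affineForm]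

theorem degree_le_totalDegree {f : MvPolynomial (Fin n) K} {d : Fin n →₀ ℕ}
    (hd : d ∈ f.support) : d.degree ≤ f.totalDegree := by
  rw [Finsupp.degree_apply]
  exact le_totalDegree hd

theorem isHomogeneous_homogenize (f : MvPolynomial (Fin n) K) :
    (homogenize f).IsHomogeneous f.totalDegree := by
  refine IsHomogeneous.sum _ _ _ fun d hd => isHomogeneous_monomial _ ?_
  have hle : d.degree ≤ f.totalDegree := degree_le_totalDegree hd
  rw [Finsupp.degree_eq_sum, Fin.sum_univ_succ]
  simp only [Finsupp.cons_zero, Finsupp.cons_succ]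
  rw [← Finsupp.degree_eq_sum]
  omega

/-- Only terms of top degree receive no factor `x₀`. -/
theorem homogenize_sub_rename_mem (f : MvPolynomial (Fin n) K) :
    homogenize f - rename Fin.succ (homogeneousComponent f.totalDegree f) ∈
      Ideal.span {(X 0 : MvPolynomial (Fin (n + 1)) K)} := by
  classical
  rw [homogeneousComponent_apply, homogenize, map_sum, Finset.sum_filter,
    ← Finset.sum_sub_distrib]
  refine Ideal.sum_mem _ fun d hd => ?_
  have hle := degree_le_totalDegree hd
  split_ifs with h
  · have hcons : Finsupp.mapDomain Fin.succ d = Finsupp.cons 0 d := by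
      ext j
      refine Fin.cases ?_ (fun j => ?_) j
      · rw [Finsupp.cons_zero, Finsupp.mapDomain_of_notMem_range]
        rintro ⟨i, hi⟩
        exact Fin.succ_ne_zero i hi
      · rw [Finsupp.cons_succ, Finsupp.mapDomain_apply (Fin.succ_injective n)]
    rw [rename_monomial, hcons, h, Nat.sub_self, sub_self]
    exact Ideal.zero_mem _
  · rw [sub_zero, Ideal.mem_span_singleton, X_dvd_monomial]
    right
    rw [Finsupp.cons_zero]
    omega

theorem aeval_homogenize {L : Type*} [Field L] [Algebra K L] (f : MvPolynomial (Fin n) K)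
    {x : Fin (n + 1) → L} (hx : x 0 ≠ 0) :
    aeval x (homogenize f) = x 0 ^ f.totalDegree * aeval (fun i => x i.succ / x 0) f := by
  conv_rhs => rw [← f.support_sum_monomial_coeff, map_sum, f.support_sum_monomial_coeff]
  rw [homogenize, map_sum, Finset.mul_sum]
  refine Finset.sum_congr rfl fun d hd => ?_
  have hle := degree_le_totalDegree hd
  have hpow : x 0 ^ f.totalDegree = x 0 ^ (f.totalDegree - d.degree) * ∏ i, x 0 ^ d i := by
    rw [Finset.prod_pow_eq_pow_sum, ← Finsupp.degree_eq_sum, ← pow_add, Nat.sub_add_cancel hle]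
  rw [aeval_monomial, aeval_monomial, Finsupp.prod_fintype _ _ (fun _ => pow_zero _),
    Finsupp.prod_fintype _ _ (fun _ => pow_zero _), Fin.prod_univ_succ, Finsupp.cons_zero]
  simp only [Finsupp.cons_succ, div_pow, Finset.prod_div_distrib]
  rw [hpow]
  have h0 : ∏ i, x 0 ^ d i ≠ 0 := Finset.prod_ne_zero_iff.2 fun i _ => pow_ne_zero _ hx
  field_simp

/-- If `f x` times `M ^ i` lies in `J`, then `f` times `M ^ (N + i)` does: the first `N` factors are
replaced by an element of `J` plus a multiple of `x`. -/
theorem mem_saturation_of_mul_mem {R : Type*} [CommRing R] {J M : Ideal R} {x f : R} {N : ℕ}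
    (hN : M ^ N ≤ J ⊔ Ideal.span {x}) (h : f * x ∈ saturation J M) : f ∈ saturation J M := by
  obtain ⟨i, hi⟩ := h
  refine ⟨N + i, fun u hu => ?_⟩
  rw [pow_add] at hu
  refine Submodule.mul_induction_on hu (fun v hv w hw => ?_) fun v w hv hw => ?_
  · obtain ⟨j, hj, r, hr, rfl⟩ := Submodule.mem_sup.1 (hN hv)
    obtain ⟨s, rfl⟩ := Ideal.mem_span_singleton.1 hr
    have : f * ((j + x * s) * w) = f * w * j + s * (f * x * w) := by ring
    rw [this]
    exact J.add_mem (J.mul_mem_left _ hj) (J.mul_mem_left _ (hi w hw))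
  · rw [mul_add]
    exact J.add_mem hv hw

/-- Modulo `x₀`, the `i`-th homogenization is a unit times a power of the linear form of row `i`, so
that form lies in the radical of `J + (x₀)`. Inverting `A` puts all variables there, and finite
generation yields a uniform exponent. -/
theorem exists_irrelevantIdeal_pow_le {g : Fin n → Polynomial K} (hg : ∀ i, 0 < (g i).natDegree)
    {A : Matrix (Fin n) (Fin n) K} (b : Fin n → K) (hA : IsUnit A.det)
    {J : Ideal (MvPolynomial (Fin (n + 1)) K)}
    (hJ : ∀ i, homogenize (affinelyDerived g A b i) ∈ J) :
    ∃ N, irrelevantIdeal K n ^ N ≤ J ⊔ Ideal.span {X 0} := by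
  have hform : ∀ i, rename Fin.succ (affineForm (A i) 0) ∈ (J ⊔ Ideal.span {X 0}).radical := by
    intro i
    have hl0 : affineForm (A i) 0 ≠ 0 := by
      intro h0
      -- The linear form is the image of a variable under the automorphism with zero translation.
      rw [← Pi.zero_apply (M := fun _ => K) i, ← affineEquiv_X A 0 hA i] at h0
      exact X_ne_zero i ((map_eq_zero_iff _ (affineEquiv A 0 hA).injective).1 h0)
    have hl := isHomogeneous_affineForm_zero (A i)
    have hmem : homogenize (affinelyDerived g A b i) ∈ J ⊔ Ideal.span {X 0} :=
      Ideal.mem_sup_left (hJ i)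
    have hdiff := Ideal.mem_sup_right (S := J)
      (homogenize_sub_rename_mem (affinelyDerived g A b i))
    have h := (Submodule.sub_mem_iff_right _ hmem).1 hdiff
    rw [affinelyDerived, aeval_affineForm_eq_aeval_taylor,
      totalDegree_aeval_of_isHomogeneous_one hl hl0,
      homogeneousComponent_aeval_of_isHomogeneous_one hl, map_mul, map_pow, rename_C] at h
    refine ⟨_, (Ideal.unit_mul_mem_iff_mem _ ?_).1 h⟩
    refine (isUnit_iff_ne_zero.2 ?_).map C
    rw [Polynomial.coeff_natDegree, Polynomial.leadingCoeff_ne_zero]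
    intro h0
    have := hg i
    rw [← Polynomial.natDegree_taylor (g i) (b i), h0] at this
    simp at this
  refine Ideal.exists_pow_le_of_le_radical_of_fg ?_
    (Submodule.fg_span (Set.finite_range _))
  rw [irrelevantIdeal, Ideal.span_le]
  rintro _ ⟨j, rfl⟩
  refine Fin.cases ?_ (fun j => ?_) j
  · exact Ideal.le_radical (Ideal.mem_sup_right (Ideal.mem_span_singleton_self _))
  · have h : (X j : MvPolynomial (Fin n) K) =
        ∑ i, C (A⁻¹ j i) * affineForm (A i) 0 := by
      have h := aeval_affineForm_affineForm A 0 (A⁻¹ j) 0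
      rw [← Matrix.mul_apply_eq_vecMul, Matrix.nonsing_inv_mul A hA, dotProduct_zero, add_zero,
        affineForm_one, aeval_affineForm, map_zero, add_zero] at h
      exact h.symm
    rw [← rename_X Fin.succ j, h, map_sum]
    refine Ideal.sum_mem _ fun i _ => ?_
    rw [map_mul]
    exact Ideal.mul_mem_left _ _ (hform i)

theorem isInGenericCoordinates_homogenize {g : Fin n → Polynomial K}
    (hg : ∀ i, 0 < (g i).natDegree) (A : Matrix (Fin n) (Fin n) K) (b : Fin n → K)
    (hA : IsUnit A.det) {G : Set (MvPolynomial (Fin n) K)}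
    (hG : ∀ i, affinelyDerived g A b i ∈ G) :
    IsInGenericCoordinates (Ideal.span (homogenize '' G)) := by
  have hJ : ∀ i, homogenize (affinelyDerived g A b i) ∈ Ideal.span (homogenize '' G) :=
    fun i => Ideal.subset_span ⟨_, hG i, rfl⟩
  obtain ⟨N, hN⟩ := exists_irrelevantIdeal_pow_le hg b hA hJ
  -- Regularity of `x₀` is proved whether or not there are projective zeros.
  refine ⟨?_, ?_, Or.inr ?_⟩
  · refine Ideal.homogeneous_span _ _ ?_
    rintro _ ⟨f, -, rfl⟩
    exact ⟨_, isHomogeneous_homogenize f⟩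
  -- At a zero with `x₀ = 0`, the `N`-th power of every coordinate would vanish. So all zeros lie in
  -- the affine chart `x₀ ≠ 0`, where they dehomogenize injectively to zeros of the affine system.
  · have hx0 : ∀ p ∈ projZeroLocus (AlgebraicClosure K) (Ideal.span (homogenize '' G)),
        p.rep 0 ≠ 0 := by
      intro p hp h0
      have hle : Ideal.span (homogenize '' G) ⊔ Ideal.span {X 0} ≤
          RingHom.ker (aeval p.rep : _ →ₐ[K] AlgebraicClosure K) := by
        refine sup_le hp ?_
        rw [Ideal.span_singleton_le_iff_mem, RingHom.mem_ker, aeval_X, h0]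
      refine p.rep_nonzero (funext fun j => ?_)
      have := hle (hN (Ideal.pow_mem_pow (Ideal.subset_span (Set.mem_range_self j)) N))
      rw [RingHom.mem_ker, map_pow, aeval_X] at this
      exact eq_zero_of_pow_eq_zero this
    refine Set.Finite.of_injOn
      (f := fun (p : Projectivization (AlgebraicClosure K) (Fin (n + 1) → AlgebraicClosure K)) i =>
        p.rep (Fin.succ i) / p.rep 0) ?_ ?_
      (finite_zeros_affinelyDerived (AlgebraicClosure K)
        (fun i => Polynomial.ne_zero_of_natDegree_gt (hg i)) A b hA)
    · intro p hp i
      have := hp _ (hJ i)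
      rw [aeval_homogenize _ (hx0 p hp)] at this
      exact (mul_eq_zero.1 this).resolve_left (pow_ne_zero _ (hx0 p hp))
    · intro p hp q hq h
      rw [← p.mk_rep, ← q.mk_rep, Projectivization.mk_eq_mk_iff']
      refine ⟨p.rep 0 / q.rep 0, funext fun j => ?_⟩
      have hq0 := hx0 q hq
      have hp0 := hx0 p hp
      refine Fin.cases ?_ (fun j => ?_) j
      · simp [hq0]
      · have hj := congrFun h j
        simp only at hj
        rw [div_eq_div_iff hp0 hq0] at hj
        rw [Pi.smul_apply, smul_eq_mul, div_mul_eq_mul_div, div_eq_iff hq0, hj, mul_comm]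
  · rw [mem_nonZeroDivisors_iff_right]
    intro z hz
    obtain ⟨f, rfl⟩ := Ideal.Quotient.mk_surjective z
    rw [← map_mul, Ideal.Quotient.eq_zero_iff_mem] at hz
    exact Ideal.Quotient.eq_zero_iff_mem.2 (mem_saturation_of_mul_mem hN hz)

end GenericCoordinates

end AffineSystem

end

/-! ### Rank, base change to the algebraic closure, and assembly -/

namespace AffineSystem

theorem isUnit_det_of_rank_eq {k : Type*} [Field k] {n : ℕ} {A : Matrix (Fin n) (Fin n) k}
    (hA : A.rank = n) : IsUnit A.det := by
  rw [← Matrix.isUnit_iff_isUnit_det, ← Matrix.linearIndependent_rows_iff_isUnit,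
    linearIndependent_iff_card_eq_finrank_span, Fintype.card_fin, Set.finrank,
    ← Matrix.rank_eq_finrank_span_row, hA]

/-- Over `K` the system is again affinely derived, so the generic coordinates result applies there
directly. -/
theorem map_affinelyDerived {k K : Type*} [Field k] [Field K] [Algebra k K] {n : ℕ}
    (g : Fin n → Polynomial k) (A : Matrix (Fin n) (Fin n) k) (b : Fin n → k) (i : Fin n) :
    MvPolynomial.map (algebraMap k K) (affinelyDerived g A b i) =
      affinelyDerived (fun i => (g i).map (algebraMap k K)) (A.map (algebraMap k K))
        (fun i => algebraMap k K (b i)) i := by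
  have h : MvPolynomial.map (algebraMap k K) (affineForm (A i) (b i)) =
      affineForm (A.map (algebraMap k K) i) (algebraMap k K (b i)) := by
    simp [affineForm]
  rw [affinelyDerived, affinelyDerived, ← h]
  refine Polynomial.map_aeval_eq_aeval_map ?_ _ _
  ext a
  simp [MvPolynomial.algebraMap_eq]

end AffineSystem

theorem mainTheorem1 {k : Type*} [Field k] {K : Type*} [Field K] [Algebra k K] [IsAlgClosure k K]
    (n : ℕ) (hn : 1 ≤ n)
    (g : Fin n → Polynomial k) (hg : ∀ i, 0 < (g i).natDegree)
    (A : Matrix (Fin n) (Fin n) k) (b : Fin n → k) (hA : A.rank = n)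
    (F : Fin n → MvPolynomial (Fin n) k) (hF : F = AffineSystem.affinelyDerived g A b) :
    -- (1) the affine change of variables `y = A x + b` is invertible and turns the system
    -- into a Gröbner basis for all LEX and DRL term orders
    (∃ φ : MvPolynomial (Fin n) k ≃ₐ[k] MvPolynomial (Fin n) k,
      (∀ i, φ (MvPolynomial.X i) = AffineSystem.affineForm (A i) (b i)) ∧
      (∀ i, φ.symm (MvPolynomial.X i) =
        AffineSystem.affineForm (A⁻¹ i) (-(A⁻¹.mulVec b) i)) ∧
      (∀ i, φ.symm (F i) = Polynomial.aeval (MvPolynomial.X i) (g i)) ∧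
      ∀ e : Equiv.Perm (Fin n),
        AffineSystem.IsGroebnerBasis (AffineSystem.LEX e)
          ((Ideal.span (Set.range F)).map φ.symm) (Set.range fun i => φ.symm (F i)) ∧
        AffineSystem.IsGroebnerBasis (AffineSystem.DRL e)
          ((Ideal.span (Set.range F)).map φ.symm) (Set.range fun i => φ.symm (F i))) ∧
    -- (2) the system is zero-dimensional
    (ringKrullDim (MvPolynomial (Fin n) k ⧸ Ideal.span (Set.range F)) = 0 ∧
      (AffineSystem.zeroLocus K (Ideal.span (Set.range F))).Finite) ∧
    -- (3) the dimension of the quotient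
    (Module.Finite k (MvPolynomial (Fin n) k ⧸ Ideal.span (Set.range F)) ∧
      Module.finrank k (MvPolynomial (Fin n) k ⧸ Ideal.span (Set.range F)) =
        ∏ i, (g i).natDegree) ∧
    -- (4) larger proper systems over the algebraic closure are in generic coordinates
    (∀ G : Set (MvPolynomial (Fin n) K),
      (∀ i, MvPolynomial.map (algebraMap k K) (F i) ∈ G) →
      Ideal.span G ≠ ⊤ →
      AffineSystem.IsInGenericCoordinates (Ideal.span (AffineSystem.homogenize '' G))) ∧
    -- (5) radicality over finite fields
    (Finite k →
      (∀ i, g i ∣ (Polynomial.X ^ Nat.card k - Polynomial.X : Polynomial k)) →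
      ∀ I : Ideal (MvPolynomial (Fin n) k), (∀ i, F i ∈ I) → I.IsRadical) := by
  have hdet := AffineSystem.isUnit_det_of_rank_eq hA
  subst hF
  have hfin := AffineSystem.finite_quotient_aeval_X hg
  have hrank := AffineSystem.finrank_quotient_aeval_X hg
  have hequiv := AffineSystem.quotientAffinelyDerivedEquiv g A b hdet
  have hfinite : Module.Finite k (MvPolynomial (Fin n) k ⧸
      Ideal.span (Set.range (AffineSystem.affinelyDerived g A b))) :=
    Module.Finite.equiv hequiv.symm.toLinearEquiv
  have hfinrank : Module.finrank k (MvPolynomial (Fin n) k ⧸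
      Ideal.span (Set.range (AffineSystem.affinelyDerived g A b))) = ∏ i, (g i).natDegree :=
    hequiv.toLinearEquiv.finrank_eq.trans hrank
  have hgroebner (m : MonomialOrder (Fin n)) : AffineSystem.IsGroebnerBasis m
      ((Ideal.span (Set.range (AffineSystem.affinelyDerived g A b))).map
        (AffineSystem.affineEquiv A b hdet).symm)
      (Set.range fun i => (AffineSystem.affineEquiv A b hdet).symm
        (AffineSystem.affinelyDerived g A b i)) := by
    rw [AffineSystem.map_span_affinelyDerived]
    simp only [AffineSystem.affineEquiv_symm_affinelyDerived]
    exact AffineSystem.isGroebnerBasis_aeval_X m hg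
  refine ⟨⟨AffineSystem.affineEquiv A b hdet, AffineSystem.affineEquiv_X A b hdet,
    AffineSystem.affineEquiv_symm_X A b hdet,
    AffineSystem.affineEquiv_symm_affinelyDerived g A b hdet,
    fun e => ⟨hgroebner _, hgroebner _⟩⟩, ⟨?_, ?_⟩, ⟨hfinite, hfinrank⟩, ?_, ?_⟩
  -- The Krull dimension is 0 rather than `⊥` because the product of the degrees is positive, so the
  -- quotient is not the zero ring.
  · have : Nontrivial (MvPolynomial (Fin n) k ⧸
        Ideal.span (Set.range (AffineSystem.affinelyDerived g A b))) :=
      Module.nontrivial_of_finrank_pos (R := k)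
        (hfinrank ▸ Finset.prod_pos fun i _ => hg i)
    have : IsArtinianRing (MvPolynomial (Fin n) k ⧸
        Ideal.span (Set.range (AffineSystem.affinelyDerived g A b))) :=
      IsArtinianRing.of_finite k _
    exact ringKrullDimZero_iff_ringKrullDim_eq_zero.1 inferInstance
  · exact (AffineSystem.finite_zeros_affinelyDerived K
      (fun i => Polynomial.ne_zero_of_natDegree_gt (hg i)) A b hdet).subset
      fun x hx i => hx _ (Ideal.subset_span ⟨i, rfl⟩)
  · intro G hG _
    refine AffineSystem.isInGenericCoordinates_homogenize
      (g := fun i => (g i).map (algebraMap k K)) (fun i => ?_) (A.map (algebraMap k K))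
      (fun i => algebraMap k K (b i)) ?_ fun i => ?_
    · rw [Polynomial.natDegree_map]
      exact hg i
    · have := hdet.map (algebraMap k K)
      rwa [RingHom.map_det] at this
    · rw [← AffineSystem.map_affinelyDerived]
      exact hG i
  · intro _ hdvd I hI
    exact AffineSystem.isRadical_of_affinelyDerived_mem hdvd A b hdet hI
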